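/- Let $X$ and $Y$ be compact Hausdorff spaces. For $f\in C(X)$, $g\in C(Y)$ (complex-valued continuous functions) write $(f\otimes g)(x,y)=f(x)g(y)$, and let $B\otimes C(Y)$ be the set of finite sums of functions $f\otimes g$ with $f\in B$, $g\in C(Y)$. A unital subalgebra $A$ of $C(K)$, $K$ compact Hausdorff, equipped with a Banach algebra norm is called self-adjoint if $f\in A$ implies $\bar f\in A$ and if $x\mapsto(f\mapsto f(x))$ is a bijection from $K$ onto the maximal ideal space of $A$. Let $B$ be a unital point separating subalgebra of $C(X)$ with a Banach algebra norm $\|\cdot\|_B$, and $\widetilde B$ a unital point separating subalgebra of $C(X\times Y)$ with a Banach algebra norm $\|\cdot\|_{\widetilde B}$, both self-adjoint, such that $B\otimes C(Y)\subset\widetilde B$. Then $\widetilde B$ is called a natural $C(Y)$-valuezation of $B$ if there are a compact Hausdorff space $\mathfrak M$ and a complex-linear map $D:\widetilde B\to C(\mathfrak M)$ such that $\ker D=\{1\otimes g: g\in C(Y)\}$, $D$ maps real-valued functions to real-valued functions, and $$\|F\|_{\widetilde B}=\sup_{X\times Y}|F|+\sup_{\mathfrak M}|D(F)|\qquad(F\in\widetilde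 B).$$ Proposition. For $j=1,2$ let $X_j,Y_j$ be compact Hausdorff spaces and let $\widetilde B_j$ be a natural $C(Y_j)$-valuezation of $B_j\subset C(X_j)$, where $X_2$ is not a singleton. Let $U:\widetilde B_1\to\widetilde B_2$ be a surjective complex-linear isometry with respect to the norms $\|\cdot\|_{\widetilde B_1}$, $\|\cdot\|_{\widetilde B_2}$. Then there exists $h\in C(Y_2)$ with $|h|=1$ on $Y_2$ such that $U(1)=1\otimes h$. -/

import Mathlib

open Filter Topology

universe w u v w₁ w₂ u₁ v₁ u₂ v₂

namespace Valuezation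

section

variable {X Y : Type*} [TopologicalSpace X] [TopologicalSpace Y]

/-- The function `f ⊗ g` on `X × Y`, `(f ⊗ g)(x, y) = f x * g y`. -/
noncomputable def tensor (f : C(X, ℂ)) (g : C(Y, ℂ)) : C(X × Y, ℂ) :=
  ⟨fun p => f p.1 * g p.2, by fun_prop⟩

/-- The space of finite sums of functions `f ⊗ g` with `f ∈ E` and `g ∈ F`. -/
noncomputable def tensorSpace (E : Submodule ℂ C(X, ℂ)) (F : Submodule ℂ C(Y, ℂ)) :
    Submodule ℂ C(X × Y, ℂ) :=
  Submodule.span ℂ {k | ∃ f ∈ E, ∃ g ∈ F, k = tensor f g}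

/-- Evaluation at a point `x`, as a complex homomorphism of an algebra of functions on `X`. -/
noncomputable def evalHom (A : Subalgebra ℂ C(X, ℂ)) (x : X) : A →ₐ[ℂ] ℂ where
  toFun f := (f : C(X, ℂ)) x
  map_one' := rfl
  map_mul' _ _ := rfl
  map_zero' := rfl
  map_add' _ _ := rfl
  commutes' _ := rfl

/-- The algebra is natural: the point evaluations are pairwise distinct and exhaust the maximal
ideal space. The maximal ideal space is taken as the set of all unital complex homomorphisms;
on a Banach algebra these are automatically continuous. -/
def IsNatural (A : Subalgebra ℂ C(X, ℂ)) : Prop :=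
  Function.Bijective (evalHom A)

/-- The algebra is self-adjoint: natural and closed under complex conjugation. -/
def IsSelfAdjointAlgebra (A : Subalgebra ℂ C(X, ℂ)) : Prop :=
  IsNatural A ∧ ∀ f ∈ A, star f ∈ A

/-- Completeness of an algebra of functions for a given algebra norm `N` (which is unrelated to
the supremum norm that the algebra inherits from `C(X, ℂ)`). -/
def IsCompleteNorm {A : Subalgebra ℂ C(X, ℂ)} (N : AlgebraNorm ℂ A) : Prop :=
  ∀ u : ℕ → A, (∀ ε : ℝ, 0 < ε → ∃ n₀ : ℕ, ∀ m ≥ n₀, ∀ n ≥ n₀, N (u m - u n) < ε) →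
    ∃ a : A, Tendsto (fun n => N (u n - a)) atTop (𝓝 0)

/-- A unital, point separating, self-adjoint subalgebra of `C(X, ℂ)` for which `N` is a Banach
algebra norm. -/
structure IsSelfAdjointBanachAlgebra (A : Subalgebra ℂ C(X, ℂ)) (N : AlgebraNorm ℂ A) : Prop where
  separatesPoints : A.SeparatesPoints
  complete : IsCompleteNorm N
  selfAdjoint : IsSelfAdjointAlgebra A

end

/-- `W`, with the norm `NW`, is a natural `C(Y)`-valuezation of `B`, with the norm `NB`.
The auxiliary compact space `M` may live in any universe `w`. -/
structure IsNaturalValuezation {X : Type u} {Y : Type v}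
    [TopologicalSpace X] [CompactSpace X] [T2Space X]
    [TopologicalSpace Y] [CompactSpace Y] [T2Space Y]
    (B : Subalgebra ℂ C(X, ℂ)) (NB : AlgebraNorm ℂ B)
    (W : Subalgebra ℂ C(X × Y, ℂ)) (NW : AlgebraNorm ℂ W) : Prop where
  base : IsSelfAdjointBanachAlgebra B NB
  total : IsSelfAdjointBanachAlgebra W NW
  tensor_le : tensorSpace (Subalgebra.toSubmodule B) (⊤ : Submodule ℂ C(Y, ℂ)) ≤
    Subalgebra.toSubmodule W
  exists_map : ∃ (M : Type w) (_ : TopologicalSpace M) (_ : CompactSpace M) (_ : T2Space M)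
    (D : W →ₗ[ℂ] C(M, ℂ)),
    (∀ F : W, D F = 0 ↔ ∃ g : C(Y, ℂ), (F : C(X × Y, ℂ)) = tensor 1 g) ∧
    (∀ F : W, (∀ p, ((F : C(X × Y, ℂ)) p).im = 0) → ∀ m, (D F m).im = 0) ∧
    (∀ F : W, NW F = ‖(F : C(X × Y, ℂ))‖ + ‖D F‖)

end Valuezation

/-! ### Norm attainment and alignment. -/

namespace Valuezation

/-! In the domain, `1` is a spear: every `F` aligns with some unimodular multiple of it, and `D 1 =
0`. A surjective isometry carries this over to `u = U 1`, and equality in the total norm forces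
equality separately in the sup norm and under `D`, with the same phase `c`. The heart is
`IsSpear.map_eq_zero`. If `D u ≠ 0`, testing `u` against its real or imaginary part plus the
constant `i` yields a contradiction: `D` ignores the constant and fixes `c`, while the constant
spoils that phase in the sup norm. So `u = 1 ⊗ h`, and a Urysohn function forces `|h| = 1`. -/

theorem exists_norm_eq_norm_apply {K : Type*} [TopologicalSpace K] [CompactSpace K] [Nonempty K]
    (f : C(K, ℂ)) : ∃ p, ‖f‖ = ‖f p‖ := by
  obtain ⟨p, -, hp⟩ := isCompact_univ.exists_isMaxOn Set.univ_nonempty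
    f.continuous.norm.continuousOn
  refine ⟨p, le_antisymm ?_ (f.norm_coe_le_norm p)⟩
  rw [ContinuousMap.norm_le _ (norm_nonneg _)]
  exact fun q => hp (Set.mem_univ q)

/-- If `‖f + g‖ = ‖f‖ + ‖g‖`, then `f` and `g` attain their norms at a common point, at which
their values are positively proportional. -/
theorem exists_aligned {K : Type*} [TopologicalSpace K] [CompactSpace K] [Nonempty K]
    (f g : C(K, ℂ)) (h : ‖f + g‖ = ‖f‖ + ‖g‖) :
    ∃ p, ‖f p‖ = ‖f‖ ∧ ‖g p‖ = ‖g‖ ∧ (‖g‖ : ℂ) * f p = ‖f‖ * g p := by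
  obtain ⟨p, hp⟩ := exists_norm_eq_norm_apply (f + g)
  have hf := f.norm_coe_le_norm p
  have hg := g.norm_coe_le_norm p
  have hfg : ‖f p + g p‖ = ‖f‖ + ‖g‖ := by rw [← h, hp]; rfl
  have htri := norm_add_le (f p) (g p)
  have hfp : ‖f p‖ = ‖f‖ := by linarith
  have hgp : ‖g p‖ = ‖g‖ := by linarith
  have hray : SameRay ℝ (f p) (g p) := sameRay_iff_norm_add.2 (by linarith)
  refine ⟨p, hfp, hgp, ?_⟩
  have := hray.norm_smul_eq
  rw [hfp, hgp, Complex.real_smul, Complex.real_smul] at this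
  exact this.symm

/-- A complex number whose real part has at least its modulus equals its real part. -/
theorem im_eq_zero_of_norm_le_abs_re {z : ℂ} (h : ‖z‖ ≤ |z.re|) : z.im = 0 := by
  have h1 := Complex.sq_norm z
  rw [Complex.normSq_apply] at h1
  have h2 : ‖z‖ ^ 2 ≤ z.re ^ 2 := by
    rw [← sq_abs z.re]; gcongr
  nlinarith [sq_nonneg z.im]

/-- Spear vectors for the norm `‖F‖ + ‖D F‖`: for every `G` there is a unimodular `c` such that `G` and `c • u`
are aligned, both for the supremum norm and after applying `D`. -/
def IsSpear {K M : Type*} [TopologicalSpace K] [CompactSpace K] [TopologicalSpace M]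
    [CompactSpace M] {W : Subalgebra ℂ C(K, ℂ)} (D : W →ₗ[ℂ] C(M, ℂ)) (u : W) : Prop :=
  ∀ G : W, ∃ c : ℂ, ‖c‖ = 1 ∧
    ‖(G : C(K, ℂ)) + c • (u : C(K, ℂ))‖ = ‖(G : C(K, ℂ))‖ + ‖(u : C(K, ℂ))‖ ∧
    ‖D G + c • D u‖ = ‖D G‖ + ‖D u‖

/-! ### Spears are killed by `D`. -/

section

variable {K M : Type*} [TopologicalSpace K] [CompactSpace K] [TopologicalSpace M]
    [CompactSpace M] {W : Subalgebra ℂ C(K, ℂ)} {D : W →ₗ[ℂ] C(M, ℂ)} {u : W}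

theorem IsSpear.smul (h : IsSpear D u) {z : ℂ} (hz : ‖z‖ = 1) : IsSpear D (z • u) := by
  intro G
  have hz0 : z ≠ 0 := by rintro rfl; simp at hz
  obtain ⟨c, hc, h1, h2⟩ := h G
  refine ⟨c * z⁻¹, by simp [hc, hz], ?_, ?_⟩
  · rw [Subalgebra.coe_smul, smul_smul, inv_mul_cancel_right₀ hz0, norm_smul, hz, one_mul, h1]
  · rw [map_smul, smul_smul, inv_mul_cancel_right₀ hz0, norm_smul, hz, one_mul, h2]

/-- The useful point is that one `c` governs both the value at `p` and the value at `m`, so a phase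
found on one side can be used on the other. -/
theorem IsSpear.exists_aligned [Nonempty K] [Nonempty M] (h : IsSpear D u) (G : W) :
    ∃ c : ℂ, ‖c‖ = 1 ∧
      (∃ p, ‖(G : C(K, ℂ)) p‖ = ‖(G : C(K, ℂ))‖ ∧ ‖(u : C(K, ℂ)) p‖ = ‖(u : C(K, ℂ))‖ ∧
        (‖(u : C(K, ℂ))‖ : ℂ) * (G : C(K, ℂ)) p
          = ‖(G : C(K, ℂ))‖ * (c * (u : C(K, ℂ)) p)) ∧
      ∃ m, ‖D G m‖ = ‖D G‖ ∧ ‖D u m‖ = ‖D u‖ ∧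
        (‖D u‖ : ℂ) * D G m = ‖D G‖ * (c * D u m) := by
  obtain ⟨c, hc, h1, h2⟩ := h G
  have e1 : ‖c • (u : C(K, ℂ))‖ = ‖(u : C(K, ℂ))‖ := by rw [norm_smul, hc, one_mul]
  have e2 : ‖c • D u‖ = ‖D u‖ := by rw [norm_smul, hc, one_mul]
  obtain ⟨p, hp1, hp2, hp3⟩ := Valuezation.exists_aligned _ _ (h1.trans (by rw [e1]))
  obtain ⟨m, hm1, hm2, hm3⟩ := Valuezation.exists_aligned _ _ (h2.trans (by rw [e2]))
  rw [e1] at hp2 hp3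
  rw [e2] at hm2 hm3
  refine ⟨c, hc, ⟨p, hp1, ?_, hp3⟩, m, hm1, ?_, hm3⟩
  · simpa [hc] using hp2
  · simpa [hc] using hm2

/-- The real and imaginary parts of an element of a conjugation invariant algebra. -/
theorem exists_re_im (hstar : ∀ f ∈ W, star f ∈ W) (u : W) :
    ∃ v w : W, (∀ p, (v : C(K, ℂ)) p = (((u : C(K, ℂ)) p).re : ℂ)) ∧
      (∀ p, (w : C(K, ℂ)) p = (((u : C(K, ℂ)) p).im : ℂ)) ∧ u = v + Complex.I • w := by
  let s : W := ⟨star (u : C(K, ℂ)), hstar _ u.2⟩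
  have hs : ∀ p, (s : C(K, ℂ)) p = star ((u : C(K, ℂ)) p) := fun p => rfl
  refine ⟨(1 / 2 : ℂ) • (u + s), (-Complex.I / 2) • (u - s), fun p => ?_, fun p => ?_, ?_⟩
  · apply Complex.ext <;> simp [hs]
    ring
  · apply Complex.ext <;> simp [hs]
    ring
  · rw [smul_smul]
    have : Complex.I * (-Complex.I / 2) = 1 / 2 := by
      rw [mul_div_assoc', mul_neg, Complex.I_mul_I, neg_neg]
    rw [this, ← smul_add, add_add_sub_cancel, ← two_smul ℂ u, smul_smul]
    norm_num

/-- A spear of norm one for the norm `‖F‖ + ‖D F‖` lies in the kernel of `D`. -/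
theorem IsSpear.map_eq_zero [Nonempty K] (h : IsSpear D u)
    (hstar : ∀ f ∈ W, star f ∈ W) (hD1 : D 1 = 0)
    (hreal : ∀ F : W, (∀ p, ((F : C(K, ℂ)) p).im = 0) → ∀ m, (D F m).im = 0)
    (hu : ‖(u : C(K, ℂ))‖ + ‖D u‖ = 1) : D u = 0 := by
  by_contra hDu
  have hM : Nonempty M := by
    by_contra hM
    rw [not_nonempty_iff] at hM
    exact hDu (ContinuousMap.ext fun m => hM.elim m)
  have ha : 0 < ‖(u : C(K, ℂ))‖ := by
    rw [norm_pos_iff]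
    intro h0
    apply hDu
    have : u = 0 := Subtype.ext h0
    rw [this, map_zero]
  obtain ⟨p₀, hp₀⟩ := exists_norm_eq_norm_apply (u : C(K, ℂ))
  -- normalise so that `u` is positive at a point where it attains its norm
  wlog hpos : (u : C(K, ℂ)) p₀ = ‖(u : C(K, ℂ))‖ generalizing u
  · have hne : (‖(u : C(K, ℂ))‖ : ℂ) ≠ 0 := by exact_mod_cast ha.ne'
    set z : ℂ := star ((u : C(K, ℂ)) p₀) / ‖(u : C(K, ℂ))‖ with hz
    have hz1 : ‖z‖ = 1 := by
      rw [hz, norm_div, norm_star, ← hp₀, Complex.norm_real, norm_norm, div_self ha.ne']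
    have hz0 : z ≠ 0 := by rintro h0; simp [h0] at hz1
    have e1 : ‖((z • u : W) : C(K, ℂ))‖ = ‖(u : C(K, ℂ))‖ := by
      rw [Subalgebra.coe_smul, norm_smul, hz1, one_mul]
    have e2 : ‖D (z • u)‖ = ‖D u‖ := by rw [map_smul, norm_smul, hz1, one_mul]
    refine this (h.smul hz1) (by rw [e1, e2, hu]) ?_ (by rwa [e1]) ?_ ?_
    · rw [map_smul]
      exact smul_ne_zero hz0 hDu
    · rw [e1, hp₀, Subalgebra.coe_smul, ContinuousMap.smul_apply, norm_smul, hz1, one_mul]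
    · rw [e1, Subalgebra.coe_smul, ContinuousMap.smul_apply, smul_eq_mul, hz, div_mul_eq_mul_div,
        div_eq_iff hne]
      have := Complex.conj_mul' ((u : C(K, ℂ)) p₀)
      rw [← hp₀] at this
      rw [← sq]
      exact this
  have hb : 0 < ‖D u‖ := norm_pos_iff.2 hDu
  obtain ⟨v, w, hv, hw, huvw⟩ := exists_re_im hstar u
  have hDv := hreal v (fun p => by simp [hv])
  have hDw := hreal w (fun p => by simp [hw])
  have hDuvw : D u = D v + Complex.I • D w := by
    conv_lhs => rw [huvw]
    rw [map_add, map_smul]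
  have hDre : ∀ m, D v m = ((D u m).re : ℂ) := fun m => by
    apply Complex.ext <;> simp [hDuvw, hDv m, hDw m]
  have hne : (‖(u : C(K, ℂ))‖ : ℂ) ≠ 0 := by exact_mod_cast ha.ne'
  have hbne : (‖D u‖ : ℂ) ≠ 0 := by exact_mod_cast hb.ne'
  have normI : ∀ r : ℝ, ‖Complex.I + (r : ℂ)‖ ^ 2 = 1 + r ^ 2 := fun r => by
    rw [Complex.sq_norm, Complex.normSq_apply]; simp; ring
  -- Adding `i` to a real function `f` gives modulus `√(1 + f²)`: the maximum points of `|f|` stay,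
  -- the phase changes, and `D` does not see it.
  let j : W := Complex.I • 1
  have hj : ∀ p, (j : C(K, ℂ)) p = Complex.I := fun p => by simp [j]
  have hDj : D j = 0 := by simp [j, hD1]
  by_cases hDv0 : D v = 0
  · have hDu' : D u = Complex.I • D w := by rw [hDuvw, hDv0, zero_add]
    have hnw : ‖D w‖ = ‖D u‖ := by rw [hDu', norm_smul]; simp
    have hDG : D (j + w) = D w := by rw [map_add, hDj, zero_add]
    obtain ⟨c, hc, ⟨p, hp1, hp2, hp3⟩, m, hm1, hm2, hm3⟩ := h.exists_aligned (j + w)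
    rw [hDG, hnw] at hm3
    have hm4 := mul_left_cancel₀ hbne hm3
    have hwm : D w m ≠ 0 := by
      rw [← norm_ne_zero_iff, ← hDG, hm1, hDG, hnw]; exact hb.ne'
    have hcI : c = -Complex.I := by
      rw [hDu'] at hm4
      simp only [ContinuousMap.smul_apply, smul_eq_mul] at hm4
      have : c * Complex.I = 1 := by
        apply mul_right_cancel₀ hwm; rw [one_mul, mul_assoc]; exact hm4.symm
      linear_combination (-Complex.I) * this + c * Complex.I_mul_I
    have hGp : ∀ q, ((j + w : W) : C(K, ℂ)) q = Complex.I + (((u : C(K, ℂ)) q).im : ℂ) :=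
      fun q => by simp [hj, hw]
    set r := ((u : C(K, ℂ)) p).im with hr
    have hmax : ∀ q, ((u : C(K, ℂ)) q).im ^ 2 ≤ r ^ 2 := fun q => by
      have h1 := ((j + w : W) : C(K, ℂ)).norm_coe_le_norm q
      rw [← hp1, hGp, hGp] at h1
      have h2 : _ ^ 2 ≤ _ ^ 2 := pow_le_pow_left₀ (norm_nonneg _) h1 2
      rw [normI, normI] at h2
      linarith
    -- With `c = -i`, real parts in `hp3` give `‖u‖ r = √(1 + r²) r`, impossible for `r ≠ 0` since
    -- `‖u‖ < 1`.
    have hr0 : r = 0 := by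
      by_contra hr0
      have h3 := congrArg Complex.re hp3
      rw [hGp, hcI, ← hp1, hGp, ← hr] at h3
      simp only [Complex.re_ofReal_mul, Complex.add_re, Complex.I_re, zero_add, Complex.ofReal_re,
        neg_mul, Complex.neg_re, Complex.I_mul_re, neg_neg, ← hr] at h3
      have h4 := mul_right_cancel₀ hr0 h3
      have h5 := normI r
      rw [← h4] at h5
      have : 0 < r ^ 2 := by positivity
      nlinarith
    have hw0 : w = 0 := by
      apply Subtype.ext
      ext q
      have := hmax q
      rw [hr0] at this
      have h0 : ((u : C(K, ℂ)) q).im = 0 := by nlinarith [sq_nonneg ((u : C(K, ℂ)) q).im]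
      simp [hw, h0]
    rw [hw0, map_zero, norm_zero] at hnw
    exact hb.ne hnw
  · have hvle : ∀ q, |((u : C(K, ℂ)) q).re| ≤ ‖(u : C(K, ℂ))‖ := fun q =>
      (Complex.abs_re_le_norm _).trans ((u : C(K, ℂ)).norm_coe_le_norm q)
    have hp₀re : ((u : C(K, ℂ)) p₀).re = ‖(u : C(K, ℂ))‖ := by rw [hpos, Complex.ofReal_re]
    have hnv : ‖(v : C(K, ℂ))‖ = ‖(u : C(K, ℂ))‖ := by
      apply le_antisymm
      · rw [ContinuousMap.norm_le _ (norm_nonneg _)]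
        intro q
        rw [hv, Complex.norm_real]
        exact hvle q
      · have := (v : C(K, ℂ)).norm_coe_le_norm p₀
        rwa [hv, hp₀re, Complex.norm_real, norm_norm] at this
    -- `D v` has the same norm as `D u`
    have hnDv : ‖D v‖ = ‖D u‖ := by
      obtain ⟨c, hc, ⟨p, hp1, hp2, hp3⟩, m, hm1, hm2, hm3⟩ := h.exists_aligned v
      have him : ((u : C(K, ℂ)) p).im = 0 := by
        apply im_eq_zero_of_norm_le_abs_re
        rw [hv, Complex.norm_real, hnv] at hp1
        rw [hp2, ← hp1, Real.norm_eq_abs]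
      have hvu : (v : C(K, ℂ)) p = (u : C(K, ℂ)) p := by
        rw [hv]; apply Complex.ext <;> simp [him]
      have hup : (u : C(K, ℂ)) p ≠ 0 := by rw [← norm_ne_zero_iff, hp2]; exact ha.ne'
      have hc1 : c = 1 := by
        rw [hnv] at hp3
        have := mul_left_cancel₀ hne hp3
        rw [hvu] at this
        apply mul_right_cancel₀ hup
        rw [one_mul, ← this]
      have hDv0' : ‖D v‖ ≠ 0 := norm_ne_zero_iff.2 hDv0
      have hDim : (D u m).im = 0 := by
        have := congrArg Complex.im hm3
        rw [hc1, one_mul, Complex.im_ofReal_mul, Complex.im_ofReal_mul, hDv m, mul_zero] at this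
        exact (mul_eq_zero.1 this.symm).resolve_left hDv0'
      rw [← hm1, ← hm2, hDre]
      congr 1
      apply Complex.ext <;> simp [hDim]
    have hDG : D (j + v) = D v := by rw [map_add, hDj, zero_add]
    -- The `D` side forces `c = 1`, so `u p` must be a positive multiple of `i + Re (u p)`; yet `u
    -- p` will turn out to be real.
    obtain ⟨c, hc, ⟨p, hp1, hp2, hp3⟩, m, hm1, hm2, hm3⟩ := h.exists_aligned (j + v)
    rw [hDG, hnDv] at hm1 hm3
    have hDim : (D u m).im = 0 := by
      apply im_eq_zero_of_norm_le_abs_re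
      rw [hDre, Complex.norm_real] at hm1
      rw [hm2, ← hm1, Real.norm_eq_abs]
    have hDvu : D v m = D u m := by
      rw [hDre]; apply Complex.ext <;> simp [hDim]
    have hc1 : c = 1 := by
      have := mul_left_cancel₀ hbne hm3
      rw [hDvu] at this
      have hum : D u m ≠ 0 := by rw [← norm_ne_zero_iff, hm2]; exact hb.ne'
      apply mul_right_cancel₀ hum
      rw [one_mul, ← this]
    have hGp : ∀ q, ((j + v : W) : C(K, ℂ)) q = Complex.I + (((u : C(K, ℂ)) q).re : ℂ) :=
      fun q => by simp [hj, hv]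
    have him : ((u : C(K, ℂ)) p).im = 0 := by
      apply im_eq_zero_of_norm_le_abs_re
      have h1 := ((j + v : W) : C(K, ℂ)).norm_coe_le_norm p₀
      rw [← hp1, hGp, hGp] at h1
      have h2 : _ ^ 2 ≤ _ ^ 2 := pow_le_pow_left₀ (norm_nonneg _) h1 2
      rw [normI, normI, hp₀re, add_le_add_iff_left] at h2
      rw [hp2]
      simpa using sq_le_sq.1 h2
    have := congrArg Complex.im hp3
    rw [hc1, one_mul, Complex.im_ofReal_mul, Complex.im_ofReal_mul, him, hGp] at this
    simp at this
    exact ha.ne' (by simpa using this)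

end

/-! ### The constant `1`, and unimodularity of `h`. -/

/-- The constant function `1` is a spear for the supremum norm. -/
theorem exists_norm_add_smul_one {K : Type*} [TopologicalSpace K] [CompactSpace K] [Nonempty K]
    (F : C(K, ℂ)) : ∃ c : ℂ, ‖c‖ = 1 ∧ ‖F + c • (1 : C(K, ℂ))‖ = ‖F‖ + 1 := by
  obtain ⟨p, hp⟩ := exists_norm_eq_norm_apply F
  obtain ⟨c, hc, hFc⟩ : ∃ c : ℂ, ‖c‖ = 1 ∧ F p = ‖F p‖ * c :=
    ⟨Complex.exp (Complex.arg (F p) * Complex.I), Complex.norm_exp_ofReal_mul_I _,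
      (Complex.norm_mul_exp_arg_mul_I _).symm⟩
  refine ⟨c, hc, le_antisymm ?_ ?_⟩
  · refine (norm_add_le _ _).trans ?_
    rw [norm_smul, hc, norm_one, one_mul]
  · have h1 := (F + c • (1 : C(K, ℂ))).norm_coe_le_norm p
    have h2 : (F + c • (1 : C(K, ℂ))) p = ((‖F‖ + 1 : ℝ) : ℂ) * c := by
      simp only [ContinuousMap.add_apply, ContinuousMap.smul_apply, ContinuousMap.one_apply,
        smul_eq_mul, mul_one]
      rw [hFc, ← hp]; push_cast; ring
    rw [h2, norm_mul, hc, mul_one, Complex.norm_real, Real.norm_of_nonneg (by positivity)] at h1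
    exact h1

theorem tensor_one_one {X Y : Type*} [TopologicalSpace X] [TopologicalSpace Y] :
    tensor (1 : C(X, ℂ)) (1 : C(Y, ℂ)) = 1 := by
  ext p; simp [tensor]

/-- If a function `1 ⊗ h` of norm one is aligned, up to a unimodular factor, with every
`1 ⊗ g`, then `h` is unimodular. -/
theorem norm_eq_one_of_aligned {X Y : Type*} [TopologicalSpace X] [CompactSpace X] [Nonempty X]
    [TopologicalSpace Y] [CompactSpace Y] [T2Space Y] (h : C(Y, ℂ))
    (hnorm : ‖tensor (1 : C(X, ℂ)) h‖ = 1)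
    (hal : ∀ g : C(Y, ℂ), ∃ c : ℂ, ‖c‖ = 1 ∧
      ‖tensor (1 : C(X, ℂ)) g + c • tensor (1 : C(X, ℂ)) h‖ = ‖tensor (1 : C(X, ℂ)) g‖ + 1)
    (y : Y) : ‖h y‖ = 1 := by
  by_contra hy
  have : Nonempty Y := ⟨y⟩
  -- Alignment makes `f` attain its norm where `|h| = 1`, but `f` vanishes there.
  obtain ⟨f, hf0, hf1, -⟩ := exists_continuous_zero_one_of_isClosed
    (isClosed_eq (h.continuous.norm) continuous_const : IsClosed {z | ‖h z‖ = 1})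
    (isClosed_singleton (x := y)) (Set.disjoint_singleton_right.2 hy)
  let g : C(Y, ℂ) := ⟨fun z => (f z : ℂ), by fun_prop⟩
  obtain ⟨c, hc, hg⟩ := hal g
  have e1 : ‖c • tensor (1 : C(X, ℂ)) h‖ = 1 := by rw [norm_smul, hc, one_mul, hnorm]
  obtain ⟨p, hp1, hp2, -⟩ := exists_aligned _ _ (hg.trans (by rw [e1]))
  have hhp : ‖h p.2‖ = 1 := by
    rw [e1] at hp2
    simpa [hc, tensor] using hp2
  have hfp : f p.2 = 0 := hf0 hhp
  have h0 : ‖tensor (1 : C(X, ℂ)) g‖ = 0 := by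
    rw [← hp1]; simp [tensor, g, hfp]
  obtain ⟨x⟩ := ‹Nonempty X›
  have h1 := (tensor (1 : C(X, ℂ)) g).norm_coe_le_norm (x, y)
  have hfy : f y = 1 := hf1 rfl
  rw [h0] at h1
  simp [tensor, g, hfy] at h1
  linarith

end Valuezation

/-! ### Transfer along the isometry. -/

theorem proposition6p1
    {X₁ : Type u₁} {Y₁ : Type v₁} {X₂ : Type u₂} {Y₂ : Type v₂}
    [TopologicalSpace X₁] [CompactSpace X₁] [T2Space X₁]
    [TopologicalSpace Y₁] [CompactSpace Y₁] [T2Space Y₁]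
    [TopologicalSpace X₂] [CompactSpace X₂] [T2Space X₂]
    [TopologicalSpace Y₂] [CompactSpace Y₂] [T2Space Y₂]
    [Nontrivial X₂]
    (B₁ : Subalgebra ℂ C(X₁, ℂ)) (NB₁ : AlgebraNorm ℂ B₁)
    (W₁ : Subalgebra ℂ C(X₁ × Y₁, ℂ)) (NW₁ : AlgebraNorm ℂ W₁)
    (B₂ : Subalgebra ℂ C(X₂, ℂ)) (NB₂ : AlgebraNorm ℂ B₂)
    (W₂ : Subalgebra ℂ C(X₂ × Y₂, ℂ)) (NW₂ : AlgebraNorm ℂ W₂)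
    (h₁ : Valuezation.IsNaturalValuezation.{w₁} B₁ NB₁ W₁ NW₁)
    (h₂ : Valuezation.IsNaturalValuezation.{w₂} B₂ NB₂ W₂ NW₂)
    (U : W₁ →ₗ[ℂ] W₂) (hU : Function.Surjective U)
    (hiso : ∀ F : W₁, NW₂ (U F) = NW₁ F) :
    ∃ h : C(Y₂, ℂ), (∀ y, ‖h y‖ = 1) ∧
      ((U 1 : W₂) : C(X₂ × Y₂, ℂ)) = Valuezation.tensor 1 h := by
  rcases isEmpty_or_nonempty Y₂ with hY | hY
  · exact ⟨1, fun y => (hY.false y).elim, ContinuousMap.ext fun p => (hY.false p.2).elim⟩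
  obtain ⟨M₁, _, _, _, D₁, hker₁, -, hN₁⟩ := h₁.exists_map
  obtain ⟨M₂, _, _, _, D₂, hker₂, hreal₂, hN₂⟩ := h₂.exists_map
  -- Otherwise `W₁` is zero, and surjectivity would give `1 = 0` in `W₂`.
  have hK₁ : Nonempty (X₁ × Y₁) := by
    by_contra hK
    rw [not_nonempty_iff] at hK
    obtain ⟨F, hF⟩ := hU 1
    have hF0 : F = 0 := Subtype.ext (ContinuousMap.ext fun p => hK.elim p)
    rw [hF0, map_zero] at hF
    obtain ⟨p⟩ : Nonempty (X₂ × Y₂) := inferInstance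
    have := congrArg (fun G : W₂ => (G : C(X₂ × Y₂, ℂ)) p) hF
    simp at this
  have hD₁ : D₁ 1 = 0 := (hker₁ 1).2 ⟨1, Valuezation.tensor_one_one.symm⟩
  have hD₂ : D₂ 1 = 0 := (hker₂ 1).2 ⟨1, Valuezation.tensor_one_one.symm⟩
  have hu : ‖((U 1 : W₂) : C(X₂ × Y₂, ℂ))‖ + ‖D₂ (U 1)‖ = 1 := by
    rw [← hN₂, hiso, hN₁, hD₁, norm_zero, add_zero, Subalgebra.coe_one, norm_one]
  have hspear : Valuezation.IsSpear D₂ (U 1) := by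
    intro G
    obtain ⟨F, rfl⟩ := hU G
    obtain ⟨c, hc, hFc⟩ := Valuezation.exists_norm_add_smul_one (F : C(X₁ × Y₁, ℂ))
    have hsum : NW₂ (U F + c • U 1) = NW₂ (U F) + 1 := by
      rw [← map_smul, ← map_add, hiso, hiso, hN₁, hN₁, map_add, map_smul, hD₁, smul_zero, add_zero,
        Subalgebra.coe_add, Subalgebra.coe_smul, Subalgebra.coe_one, hFc]
      ring
    rw [hN₂, hN₂, map_add, map_smul, Subalgebra.coe_add, Subalgebra.coe_smul] at hsum
    have t1 := norm_add_le ((U F : W₂) : C(X₂ × Y₂, ℂ)) (c • ((U 1 : W₂) : C(X₂ × Y₂, ℂ)))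
    have t2 := norm_add_le (D₂ (U F)) (c • D₂ (U 1))
    rw [norm_smul, hc, one_mul] at t1 t2
    -- Two triangle inequalities whose sum is an equality are both equalities.
    exact ⟨c, hc, by linarith, by linarith⟩
  have hDu := hspear.map_eq_zero h₂.total.selfAdjoint.2 hD₂ hreal₂ hu
  obtain ⟨h, hh⟩ := (hker₂ (U 1)).1 hDu
  rw [hDu, norm_zero, add_zero, hh] at hu
  refine ⟨h, Valuezation.norm_eq_one_of_aligned (X := X₂) h hu fun g => ?_, hh⟩
  have hg : Valuezation.tensor 1 g ∈ W₂ :=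
    h₂.tensor_le (Submodule.subset_span ⟨1, B₂.one_mem, g, trivial, rfl⟩)
  obtain ⟨c, hc, h1, -⟩ := hspear ⟨_, hg⟩
  rw [hh, hu] at h1
  exact ⟨c, hc, h1⟩
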